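/- Let $G=\mathrm{PSL}_2(\mathbb C)$ act on the upper half-space $\mathbb H^3=\{z+jy: z\in\mathbb C,\ y>0\}$ and on its boundary $\partial\mathbb H^3=\mathbb C\cup\{\infty\}$, let $o=j$, and let $K=\mathrm{PSU}(2)$ be the stabilizer of $o$. Put $$a_s=\begin{pmatrix}e^{s/2}&0\\0&e^{-s/2}\end{pmatrix},\quad n_z=\begin{pmatrix}1&0\\z&1\end{pmatrix},\quad m_\theta=\begin{pmatrix}e^{i\theta}&0\\0&e^{-i\theta}\end{pmatrix},\quad u_t=n_t\ (t\in\mathbb R),$$ $U=\{u_t:t\in\mathbb R\}$, $M=\{m_\theta\}$, and identify $K/M$ with $\partial\mathbb H^3$ by $kM\mapsto k(0)$. Let $\Gamma$ be a non-elementary (i.e. not virtually abelian) discrete subgroup of $G$ and let $\delta$ be its critical exponent, the abscissa of convergence of $\sum_{\gamma\in\Gamma}e^{-s\,d(o,\gamma o)}$. Let $\{\nu_x\}_{x\in\mathbb H^3}$ be a Patterson–Sullivan density of $\Gamma$: a family of non-zero finite Borel measures on $\partial\mathbb H^3$, supported on the limit set of $\Gamma$, with $\gamma_*\nu_x=\nu_{\gamma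 x}$ for $\gamma\in\Gamma$ and $\frac{d\nu_y}{d\nu_x}(\xi)=e^{-\delta\beta_\xi(y,x)}$, where $\beta_\xi(x,y)=\lim_{s\to\infty}\big(d(x,\xi_s)-d(y,\xi_s)\big)$ for the geodesic ray $\xi_s$ from $o$ to $\xi$. Lift $\nu_o$ to a right $M$-invariant measure on $K$ by means of the probability Haar measure of $M$. The Burger–Roblin measure $m^{\mathrm{BR}}$ on $X=\Gamma\backslash G$ is the measure induced by the left $\Gamma$-invariant measure $$\tilde m^{\mathrm{BR}}(\psi)=\int\psi(ka_sn_z)\,e^{-\delta s}\,d\nu_o(k)\,ds\,dz\qquad(\psi\in C_c(G))$$ on $G$. The group $U$ acts on $X$ by right translations $x\mapsto xu_t$. **Theorem.** Suppose that $\Gamma$ is finitely generated and Fuchsian, i.e. contained in a conjugate of $\mathrm{PSL}_2(\mathbb R)$. Then $m^{\mathrm{BR}}$ is not $U$-ergodic: there is a $U$-invariant Borel set $B\subseteq X$ with $m^{\mathrm{BR}}(B)>0$ and $m^{\mathrm{BR}}(X\setminus B)>0$. Moreover: 1. If $h\in G$ satisfies $\Gamma\subseteq h\,\mathrm{PSL}_2(\mathbb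 R)h^{-1}$ and $H=h\{z+jy:\operatorname{Im}z=0\}$ is the corresponding $\Gamma$-invariant geodesic plane, then for $m^{\mathrm{BR}}$-almost every $x=\Gamma g\in X$ one has $d(gu_to,H)\to\infty$ as $|t|\to\infty$. 2. For $m^{\mathrm{BR}}$-almost every $x\in X$, $xu_t$ leaves every compact subset of $X$ as $|t|\to\infty$. 3. $m^{\mathrm{BR}}$ is not $U$-conservative: there is a Borel set $S\subseteq X$ with $m^{\mathrm{BR}}(S)>0$ such that it is not the case that for $m^{\mathrm{BR}}$-almost every $x\in S$ the set $\{t\in\mathbb R: xu_t\in S\}$ has infinite Lebesgue measure. -/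

import Mathlib

open MeasureTheory Filter Topology Matrix
open scoped MatrixGroups ENNReal

noncomputable section

namespace Kleinian

/-! ### The group, hyperbolic 3-space and its boundary -/

/-- The group `G = PSL₂(ℂ)`, with its quotient topology. -/
abbrev G : Type := PSL(2, ℂ)

/-- `G` carries its Borel σ-algebra. -/
instance : MeasurableSpace G := borel G

instance : BorelSpace G := ⟨rfl⟩

/-- The class in `PSL₂(ℂ)` of a matrix in `SL₂(ℂ)`. -/
def toPSL : SL(2, ℂ) →* G := QuotientGroup.mk' (Subgroup.center SL(2, ℂ))

/-- The upper half-space model of hyperbolic 3-space: the points `z + j y`, `z ∈ ℂ`, `y > 0`. -/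
@[ext] structure H3 : Type where
  z : ℂ
  y : ℝ
  pos : 0 < y

/-- The base point `o = j`. -/
def o : H3 := ⟨0, 1, one_pos⟩

/-- The hyperbolic distance. -/
def hdist (p q : H3) : ℝ :=
  Real.arcosh (1 + (‖p.z - q.z‖ ^ 2 + (p.y - q.y) ^ 2) / (2 * p.y * q.y))

/-- The denominator `|c z + d|² + |c|² y²` in the Poincaré extension. -/
def den (g : SL(2, ℂ)) (p : H3) : ℝ :=
  Complex.normSq (g 1 0 * p.z + g 1 1) + Complex.normSq (g 1 0) * p.y ^ 2

lemma den_pos (g : SL(2, ℂ)) (p : H3) : 0 < den g p := by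
  have hy : 0 < p.y ^ 2 := pow_pos p.pos 2
  by_cases hc : g 1 0 = 0
  · have hd : g 1 1 ≠ 0 := by
      intro hd
      have := g.det_coe
      rw [Matrix.det_fin_two] at this
      simp [hc, hd] at this
    simp [den, hc, hd]
  · have := mul_pos (Complex.normSq_pos.2 hc) hy
    have h2 := Complex.normSq_nonneg (g 1 0 * p.z + g 1 1)
    unfold den
    linarith

/-- The isometric action of `SL₂(ℂ)` on the upper half-space (Poincaré extension of the
Möbius action). -/
def act (g : SL(2, ℂ)) (p : H3) : H3 where
  z := ((g 0 0 * p.z + g 0 1) * star (g 1 0 * p.z + g 1 1) + g 0 0 * star (g 1 0) * p.y ^ 2)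
    / (den g p : ℂ)
  y := p.y / den g p
  pos := div_pos p.pos (den_pos g p)

lemma den_cast (g : SL(2, ℂ)) (p : H3) :
    (den g p : ℂ) = (g 1 0 * p.z + g 1 1) * (star (g 1 0) * star p.z + star (g 1 1))
      + g 1 0 * star (g 1 0) * p.y ^ 2 := by
  simp [den, ← Complex.mul_conj]

lemma act_one (p : H3) : act 1 p = p := by
  ext <;> simp [act, den]

lemma mul_coe (g h : SL(2, ℂ)) (i j : Fin 2) :
    (g * h) i j = g i 0 * h 0 j + g i 1 * h 1 j := by
  change (g.1 * h.1) i j = _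
  rw [Matrix.mul_apply, Fin.sum_univ_two]

/-- The numerator of the `z`-coordinate in the Poincaré extension. -/
def num (g : SL(2, ℂ)) (p : H3) : ℂ :=
  (g 0 0 * p.z + g 0 1) * star (g 1 0 * p.z + g 1 1) + g 0 0 * star (g 1 0) * p.y ^ 2

lemma act_normSq (g : SL(2, ℂ)) (p : H3) :
    num g p * star (num g p) + (p.y : ℂ) ^ 2 =
      ((g 0 0 * p.z + g 0 1) * star (g 0 0 * p.z + g 0 1) + g 0 0 * star (g 0 0) * p.y ^ 2)
        * (den g p : ℂ) := by
  have hdet := g.det_coe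
  rw [Matrix.det_fin_two] at hdet
  have hdet' := congrArg star hdet
  simp only [star_sub, star_mul', star_one] at hdet'
  have hs2 : star (p.y : ℂ) = p.y := by simp
  rw [den_cast]
  simp only [num, star_add, star_mul', star_star, star_pow, hs2]
  linear_combination (-(p.y : ℂ) ^ 2 * (star (g 0 0) * star (g 1 1) - star (g 0 1) * star (g 1 0)))
    * hdet - (p.y : ℂ) ^ 2 * hdet'

lemma den_mul (g h : SL(2, ℂ)) (p : H3) : den (g * h) p = den g (act h p) * den h p := by
  have hD : (den h p : ℂ) ≠ 0 := by exact_mod_cast (den_pos h p).ne'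
  have key := den_cast h p
  have key2 := act_normSq h p
  have hs : star (den h p : ℂ) = den h p := by simp
  have hn : num h p / den h p = (act h p).z := rfl
  have hy : (((act h p).y : ℝ) : ℂ) = p.y / den h p := by simp [act]
  have : (den (g * h) p : ℂ) = den g (act h p) * den h p := by
    rw [den_cast, den_cast g, ← hn, hy]
    simp only [mul_coe, star_add, star_mul', star_div₀, hs]
    field_simp
    have hs2 : star (p.y : ℂ) = p.y := by simp
    simp only [num, star_add, star_mul', star_star, star_pow, hs2] at key2 ⊢
    generalize (den h p : ℂ) = D at *
    linear_combination (-(g 1 0) * star (g 1 0)) * key2 - (D * g 1 1 * star (g 1 1)) * key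
  exact_mod_cast this

lemma act_mul (g h : SL(2, ℂ)) (p : H3) : act (g * h) p = act g (act h p) := by
  have hD : (den h p : ℂ) ≠ 0 := by exact_mod_cast (den_pos h p).ne'
  have hE : (den g (act h p) : ℂ) ≠ 0 := by exact_mod_cast (den_pos g (act h p)).ne'
  have key := den_cast h p
  have key2 := act_normSq h p
  have hs : star (den h p : ℂ) = den h p := by simp
  have hn : num h p / den h p = (act h p).z := rfl
  have hy : (((act h p).y : ℝ) : ℂ) = p.y / den h p := by simp [act]
  ext
  · show num (g * h) p / _ = num g (act h p) / _
    rw [den_mul, Complex.ofReal_mul]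
    rw [num, num, ← hn, hy]
    simp only [mul_coe, star_add, star_mul', star_div₀, hs]
    field_simp
    have hs2 : star (p.y : ℂ) = p.y := by simp
    simp only [num, star_add, star_mul', star_star, star_pow, hs2] at key2 ⊢
    generalize (den h p : ℂ) = D at *
    linear_combination (-(g 0 0) * star (g 1 0)) * key2 - (D * g 0 1 * star (g 1 1)) * key
  · simp only [act, den_mul]
    have := (den_pos h p).ne'
    have h2 := (den_pos g (act h p)).ne'
    simp only [act] at h2
    field_simp

instance : MulAction SL(2, ℂ) H3 where
  smul := act
  one_smul := act_one
  mul_smul := act_mul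

lemma center_act {g : SL(2, ℂ)} (hg : g ∈ Subgroup.center SL(2, ℂ)) (p : H3) : g • p = p := by
  obtain ⟨r, hr, hrg⟩ := Matrix.SpecialLinearGroup.mem_center_iff.1 hg
  have h00 : g 0 0 = r := by rw [← hrg]; simp
  have h01 : g 0 1 = 0 := by rw [← hrg]; simp
  have h10 : g 1 0 = 0 := by rw [← hrg]; simp
  have h11 : g 1 1 = r := by rw [← hrg]; simp
  have hr' : Complex.normSq r = 1 := by
    have : ‖r‖ ^ 2 = 1 := by rw [← norm_pow]; simpa using congrArg norm hr
    rw [Complex.normSq_eq_norm_sq, this]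
  have hr2 : r * star r = 1 := by
    change r * (starRingEnd ℂ) r = 1
    rw [Complex.mul_conj, hr']; simp
  have hden : den g p = 1 := by simp [den, h10, h11, hr']
  change act g p = p
  ext
  · simp only [act, hden, h00, h01, h10, h11]
    simp only [zero_mul, add_zero, zero_add, star_zero, mul_zero, Complex.ofReal_one, div_one]
    linear_combination p.z * hr2
  · simp [act, hden]

/-- `G = PSL₂(ℂ)` acts on `ℍ³`. -/
instance : MulAction G H3 :=
  MulAction.compHom H3 (QuotientGroup.lift (Subgroup.center SL(2, ℂ))
    (MulAction.toPermHom SL(2, ℂ) H3) (fun _ hg => Equiv.ext fun p => center_act hg p))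

lemma toPSL_smul_H3 (g : SL(2, ℂ)) (p : H3) : toPSL g • p = act g p := rfl

/-- The geometric boundary `∂ℍ³ = ℂ ∪ {∞}`. -/
abbrev Bd : Type := OnePoint ℂ

instance : MeasurableSpace Bd := borel Bd

instance : BorelSpace Bd := ⟨rfl⟩

lemma center_bd {g : SL(2, ℂ)} (hg : g ∈ Subgroup.center SL(2, ℂ)) (ξ : Bd) :
    SpecialLinearGroup.toGL g • ξ = ξ := by
  obtain ⟨r, hr, hrg⟩ := Matrix.SpecialLinearGroup.mem_center_iff.1 hg
  have h00 : g.1 0 0 = r := by rw [← hrg]; simp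
  have h01 : g.1 0 1 = 0 := by rw [← hrg]; simp
  have h10 : g.1 1 0 = 0 := by rw [← hrg]; simp
  have h11 : g.1 1 1 = r := by rw [← hrg]; simp
  have hr0 : r ≠ 0 := by rintro rfl; simp at hr
  induction ξ using OnePoint.rec with
  | infty =>
    rw [OnePoint.smul_infty_eq_ite]
    exact if_pos h10
  | coe w =>
    rw [OnePoint.smul_some_eq_ite]
    simp [SpecialLinearGroup.coe_GL_coe_matrix, h00, h01, h10, h11, hr0]

/-- `G = PSL₂(ℂ)` acts on `∂ℍ³` by Möbius transformations. -/
instance : MulAction G Bd :=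
  MulAction.compHom Bd (QuotientGroup.lift (Subgroup.center SL(2, ℂ))
    ((MulAction.toPermHom (GL (Fin 2) ℂ) Bd).comp SpecialLinearGroup.toGL)
    (fun _ hg => Equiv.ext fun ξ => center_bd hg ξ))

lemma toPSL_smul_Bd (g : SL(2, ℂ)) (ξ : Bd) :
    toPSL g • ξ = SpecialLinearGroup.toGL g • ξ := rfl

/-- The unit speed geodesic ray from the base point `o = j` tending to a boundary point. -/
def ray : Bd → ℝ → H3
  | none, s => ⟨0, Real.exp s, Real.exp_pos s⟩
  | some w, s =>
    { z := w * (Real.exp (2 * s) - 1) / (Real.exp (2 * s) + Complex.normSq w)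
      y := (1 + Complex.normSq w) * Real.exp s / (Real.exp (2 * s) + Complex.normSq w)
      pos := by
        have := Complex.normSq_nonneg w
        positivity }

/-- The Busemann function `β_ξ(x, y) = lim_{s → ∞} d(x, ξ_s) - d(y, ξ_s)`, where `ξ_s` is the
geodesic ray from `o` tending to `ξ`. -/
def busemann (ξ : Bd) (x y : H3) : ℝ :=
  limUnder atTop (fun s : ℝ => hdist x (ray ξ s) - hdist y (ray ξ s))

/-! ### Subgroups of `G` -/

/-- `Γ` is non-elementary: it has no abelian subgroup of finite index. -/
def NonElementary (Γ : Subgroup G) : Prop :=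
  ¬ ∃ A : Subgroup G, A ≤ Γ ∧ A.relIndex Γ ≠ 0 ∧ ∀ a ∈ A, ∀ b ∈ A, a * b = b * a

/-- The subgroup `PSL₂(ℝ)` of `PSL₂(ℂ)`. -/
def PSL2R : Subgroup G := (toPSL.comp (SpecialLinearGroup.map Complex.ofRealHom)).range

/-- `Γ` is contained in a conjugate of `PSL₂(ℝ)`. -/
def IsFuchsian (Γ : Subgroup G) : Prop :=
  ∃ h : G, ∀ γ ∈ Γ, h⁻¹ * γ * h ∈ PSL2R

/-- The distance from the base point `g o` of `g` to the geodesic plane `h H`, where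
`H = {z + j y : Im z = 0}` is the geodesic plane preserved by `PSL₂(ℝ)`. -/
def planeDist (h g : G) : ℝ :=
  ⨅ p : {p : H3 // p.z.im = 0}, hdist (g • o) (h • (p : H3))

/-- The critical exponent: the abscissa of convergence of `∑_γ exp (-s d(o, γ o))`. -/
def criticalExponent (Γ : Subgroup G) : ℝ :=
  sInf {s : ℝ | 0 ≤ s ∧ Summable fun γ : Γ => Real.exp (-s * hdist o ((γ : G) • o))}

/-- `ℍ³` in the compactification `ℍ³ ∪ ∂ℍ³`, which is the closed half-space together with `∞`,
as a subspace of the one-point compactification of `ℂ × ℝ`. -/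
def H3.toClosure (p : H3) : OnePoint (ℂ × ℝ) := ((p.z, p.y) : ℂ × ℝ)

/-- `∂ℍ³` in the compactification `ℍ³ ∪ ∂ℍ³`. -/
def Bd.toClosure (ξ : Bd) : OnePoint (ℂ × ℝ) := OnePoint.map (fun w : ℂ => (w, (0 : ℝ))) ξ

/-- The limit set: the points of `∂ℍ³` that are accumulation points of an orbit `Γ p`,
`p ∈ ℍ³`. -/
def limitSet (Γ : Subgroup G) : Set Bd :=
  {ξ | ∃ p : H3, AccPt (Bd.toClosure ξ) (𝓟 (Set.range fun γ : Γ => ((γ : G) • p).toClosure))}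

/-! ### The Patterson–Sullivan density and the Burger–Roblin measure -/

/-- `ν` is a Patterson–Sullivan density of `Γ`: a `Γ`-invariant conformal density on `∂ℍ³` whose
dimension is the critical exponent and which is supported on the limit set. -/
structure IsPSDensity (Γ : Subgroup G) (ν : H3 → Measure Bd) : Prop where
  finite : ∀ x, IsFiniteMeasure (ν x)
  ne_zero : ∀ x, ν x ≠ 0
  invariant : ∀ γ ∈ Γ, ∀ x, (ν x).map (fun ξ => γ • ξ) = ν (γ • x)
  conformal : ∀ x y, ν y = (ν x).withDensity fun ξ =>
    ENNReal.ofReal (Real.exp (-criticalExponent Γ * busemann ξ y x))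
  supported : ∀ x, ν x (limitSet Γ)ᶜ = 0

/-- `n_z`, the lower triangular unipotent matrix. -/
def nMat (z : ℂ) : SL(2, ℂ) := ⟨!![1, 0; z, 1], by simp [Matrix.det_fin_two]⟩

/-- `u_t = n_t` for real `t`. -/
def u (t : ℝ) : G := toPSL (nMat t)

/-- `a_s = diag(e^{s/2}, e^{-s/2})`. -/
def aMat (s : ℝ) : SL(2, ℂ) :=
  ⟨!![(Real.exp (s / 2) : ℂ), 0; 0, (Real.exp (-(s / 2)) : ℂ)], by
    rw [Matrix.det_fin_two_of, ← Complex.ofReal_mul, ← Real.exp_add]; simp⟩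

/-- `m_θ = diag(e^{iθ}, e^{-iθ})`. -/
def mMat (θ : ℝ) : SL(2, ℂ) :=
  ⟨!![Complex.exp (θ * Complex.I), 0; 0, Complex.exp (-(θ * Complex.I))], by
    rw [Matrix.det_fin_two_of, ← Complex.exp_add]; simp⟩

/-- A Borel section of the map `K = PSU(2) → K/M = ∂ℍ³`, `k ↦ k(0)`. Here `0 = X₀⁻` is the
backward end point of the upward unit vector `X₀` at `o`, which is stabilized by `M`. -/
def kMat : Bd → SL(2, ℂ)
  | none => ⟨!![0, 1; -1, 0], by simp [Matrix.det_fin_two]⟩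
  | some w =>
    ⟨!![((√(1 + Complex.normSq w))⁻¹ : ℂ), w * ((√(1 + Complex.normSq w))⁻¹ : ℂ);
        -star w * ((√(1 + Complex.normSq w))⁻¹ : ℂ), ((√(1 + Complex.normSq w))⁻¹ : ℂ)], by
      have h0 : 0 < 1 + Complex.normSq w := by
        have := Complex.normSq_nonneg w
        positivity
      have h1 : ((√(1 + Complex.normSq w) : ℝ) : ℂ) ^ 2 = 1 + w * star w := by
        rw [← Complex.ofReal_pow, Real.sq_sqrt h0.le]
        change _ = 1 + w * (starRingEnd ℂ) w
        rw [Complex.mul_conj]; push_cast; rfl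
      have h2 : ((√(1 + Complex.normSq w) : ℝ) : ℂ) ≠ 0 := by
        exact_mod_cast (Real.sqrt_pos.2 h0).ne'
      rw [Matrix.det_fin_two_of]
      field_simp
      rw [h1]
      ring⟩

/-- The map `(ξ, θ, s, z) ↦ k_ξ m_θ a_s n_z`, where `k_ξ m_θ` runs over `K`. -/
def iwasawa (q : Bd × ℝ × ℝ × ℂ) : G :=
  toPSL (kMat q.1 * mMat q.2.1 * aMat q.2.2.1 * nMat q.2.2.2)

/-- The lift to `G` of the Burger–Roblin measure:
`ψ ↦ ∫ ψ(k a_s n_z) e^{-δ s} dν_o(k) ds dz`, where `ν_o` is lifted from `∂ℍ³ = K/M` to an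
`M`-invariant measure on `K` by means of the probability Haar measure of `M`. -/
def brLift (Γ : Subgroup G) (ν : H3 → Measure Bd) : Measure G :=
  ((ν o).prod
    ((ENNReal.ofReal (2 * Real.pi)⁻¹ • volume.restrict (Set.Ico 0 (2 * Real.pi))).prod
      ((volume.withDensity fun s : ℝ =>
        ENNReal.ofReal (Real.exp (-criticalExponent Γ * s))).prod
          (volume : Measure ℂ)))).map iwasawa

/-- `X = Γ \ G`, the space of orbits of the left translations by `Γ`. -/
def X (Γ : Subgroup G) : Type := MulAction.orbitRel.Quotient Γ G

instance (Γ : Subgroup G) : TopologicalSpace (X Γ) :=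
  inferInstanceAs (TopologicalSpace (Quotient (MulAction.orbitRel Γ G)))

instance (Γ : Subgroup G) : MeasurableSpace (X Γ) := borel (X Γ)

instance (Γ : Subgroup G) : BorelSpace (X Γ) := ⟨rfl⟩

/-- The projection `g ↦ Γ g`. -/
def proj (Γ : Subgroup G) : G → X Γ := Quotient.mk (MulAction.orbitRel Γ G)

lemma proj_eq_iff (Γ : Subgroup G) (g h : G) :
    proj Γ g = proj Γ h ↔ ∃ γ : Γ, (γ : G) * h = g :=
  (Quotient.eq (r := MulAction.orbitRel Γ G)).trans Iff.rfl

lemma continuous_proj (Γ : Subgroup G) : Continuous (proj Γ) := continuous_quot_mk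

/-- The measure on `Γ \ G` induced by a left `Γ`-invariant measure `μ` on `G`: the least measure
which, for every Borel set `E ⊆ G` that `g ↦ Γ g` maps injectively, is at least the image of
`μ|_E`. It is the image of the restriction of `μ` to any Borel fundamental domain. -/
def inducedMeasure (Γ : Subgroup G) (μ : Measure G) : Measure (X Γ) :=
  ⨆ (E : Set G) (_ : MeasurableSet E ∧ Set.InjOn (proj Γ) E), (μ.restrict E).map (proj Γ)

/-- For a left `Γ`-invariant `μ`, the induced measure is computed by any Borel fundamental
domain. -/
lemma inducedMeasure_eq_map_restrict (Γ : Subgroup G) [Countable Γ] (μ : Measure G)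
    (hμ : ∀ γ : Γ, μ.map (fun g => (γ : G) * g) = μ) (F : Set G) (hF : MeasurableSet F)
    (hu : ∀ g : G, ∃! γ : Γ, (γ : G) * g ∈ F) :
    inducedMeasure Γ μ = (μ.restrict F).map (proj Γ) := by
  have hπ : Measurable (proj Γ) := (continuous_proj Γ).measurable
  have hmul : ∀ γ : G, Measurable (fun g : G => γ * g) :=
    fun γ => (continuous_const_mul γ).measurable
  apply le_antisymm
  · refine iSup₂_le fun E hE => Measure.le_iff.2 fun B hB => ?_
    have hπB := hπ hB
    rw [Measure.map_apply hπ hB, Measure.map_apply hπ hB, Measure.restrict_apply hπB,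
      Measure.restrict_apply hπB]
    set T : Γ → Set G := fun γ => (proj Γ ⁻¹' B ∩ F) ∩ (fun g => (γ : G)⁻¹ * g) ⁻¹' E with hT
    have hTm : ∀ γ, MeasurableSet (T γ) := fun γ => (hπB.inter hF).inter (hmul _ hE.1)
    have hinv : ∀ γ : Γ, ∀ g : G, proj Γ ((γ : G) * g) = proj Γ g :=
      fun γ g => (proj_eq_iff Γ _ _).2 ⟨γ, rfl⟩
    have hdisj : Pairwise (Function.onFun Disjoint T) := by
      intro γ γ' hne
      refine Set.disjoint_left.2 fun x hx hx' => hne ?_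
      have h1 := hE.2 hx.2 hx'.2 ((hinv γ⁻¹ x).trans (hinv γ'⁻¹ x).symm)
      exact Subtype.ext (inv_injective (mul_right_cancel h1))
    calc μ (proj Γ ⁻¹' B ∩ E)
        ≤ μ (⋃ γ : Γ, (fun g => (γ : G) * g) ⁻¹' T γ) := by
          refine measure_mono fun g hg => ?_
          obtain ⟨γ, hγ, -⟩ := hu g
          refine Set.mem_iUnion.2 ⟨γ, ⟨?_, hγ⟩, ?_⟩
          · change proj Γ ((γ : G) * g) ∈ B
            rw [hinv]; exact hg.1
          · change (γ : G)⁻¹ * ((γ : G) * g) ∈ E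
            rw [inv_mul_cancel_left]; exact hg.2
      _ ≤ ∑' γ : Γ, μ ((fun g => (γ : G) * g) ⁻¹' T γ) := measure_iUnion_le _
      _ = ∑' γ : Γ, μ (T γ) := by
          refine tsum_congr fun γ => ?_
          rw [← Measure.map_apply (hmul γ) (hTm γ), hμ]
      _ = μ (⋃ γ, T γ) := (measure_iUnion hdisj hTm).symm
      _ ≤ μ (proj Γ ⁻¹' B ∩ F) := measure_mono (Set.iUnion_subset fun γ => Set.inter_subset_left)
  · refine le_iSup₂ (f := fun (E : Set G) (_ : MeasurableSet E ∧ Set.InjOn (proj Γ) E) =>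
      (μ.restrict E).map (proj Γ)) F ⟨hF, fun g hg h hh he => ?_⟩
    obtain ⟨γ, rfl⟩ := (proj_eq_iff Γ g h).1 he
    have := (hu h).unique (y₁ := γ) (y₂ := 1) hg (by simpa using hh)
    simp [this]

/-- The Burger–Roblin measure on `X = Γ \ G`. -/
def mBR (Γ : Subgroup G) (ν : H3 → Measure Bd) : Measure (X Γ) :=
  inducedMeasure Γ (brLift Γ ν)

/-! ### The unipotent flow -/

/-- The flow `x ↦ x u_t` on `X = Γ \ G`. -/
def flow (Γ : Subgroup G) (t : ℝ) : X Γ → X Γ :=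
  Quotient.map (fun g : G => g * u t) (by
    rintro a b ⟨γ, rfl⟩
    exact ⟨γ, (mul_assoc (γ : G) b (u t)).symm⟩)

lemma flow_proj (Γ : Subgroup G) (t : ℝ) (g : G) : flow Γ t (proj Γ g) = proj Γ (g * u t) := rfl

/-- `U`-ergodicity: every `U`-invariant Borel set is null or co-null. -/
def UErgodic (Γ : Subgroup G) (m : Measure (X Γ)) : Prop :=
  ∀ B : Set (X Γ), MeasurableSet B → (∀ t : ℝ, flow Γ t ⁻¹' B = B) → m B = 0 ∨ m Bᶜ = 0

/-- `U`-conservativity: for every Borel set `S` of positive measure, the `U`-orbit of almost every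
point of `S` spends an infinite amount of time in `S`. -/
def UConservative (Γ : Subgroup G) (m : Measure (X Γ)) : Prop :=
  ∀ S : Set (X Γ), MeasurableSet S → 0 < m S →
    ∀ᵐ x ∂(m.restrict S), volume {t : ℝ | flow Γ t x ∈ S} = ∞

end Kleinian

end

/-!
Let `h⁻¹ Γ h ≤ PSL₂(ℝ)`. For `A = (a b; c d)` in `SL₂(ℂ)` put
`J = Im (a c̄)`, `Q = Im (b c̄ + a d̄)` and `I = Im (b d̄)`; these are the coefficients of the
pullback by `A` of the form `Im (v w̄)`, which `SL₂(ℝ)` preserves. Evaluated at `h⁻¹ g`, they are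
therefore continuous functions of `Γ g` (`exists_continuous_planeForm_proj`). The signed
hyperbolic sine of the distance from `g o` to the plane `h H` is `J + I` (`slope_smul_o`), and the
flow `g ↦ g u_t` replaces `(J, Q, I)` by `(J + t Q + t² I, Q + 2 t I, I)` (`planeForm_mul_u`).

The coefficient `I` of `h⁻¹ g` vanishes exactly when the backward end point `g(0)` lies on the
boundary circle of `h H`. The limit set of `Γ` is contained in this circle (`limitSet_subset`), so
`I = 0` almost everywhere for the Burger–Roblin measure. On `{I = 0}` the function `Q` is
`U`-invariant, and at `k_ξ m_θ a_s n_z` it equals `Im (e^{2iθ} w)` with `w ≠ 0` depending on `ξ`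
only (`formCoeff_mul_iwasawa`). Since `θ` is distributed according to Haar measure on `M`,
`Q ≠ 0` almost everywhere, while `Q > 0` and `Q < 0` both have positive measure (`ae_brLift`,
`brLift_ne_zero`). So `{I = 0, Q > 0}` contradicts ergodicity.

Where `I = 0` and `Q ≠ 0`, the slope `J + t Q` tends to infinity with `|t|`, and with it the
distance to the plane (`tendsto_planeDist`). As the slope is a continuous function on `Γ \ G`, the
orbit leaves every compact set, and it spends a finite time in each of the sets
`{|J + I| < n}`; one of them has positive measure, which contradicts conservativity. Null sets
and sets of positive measure are carried between `G` and `Γ \ G` by `inducedMeasure_eq_zero` and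
`measure_preimage_proj_eq_zero`.
-/

noncomputable section

namespace Kleinian

/-! ### The pulled back Hermitian form -/

/-- The form `(v, w) ↦ Im (v w̄)` on `ℂ²` vanishes exactly on the vectors representing a point of
`ℝ ∪ {∞}`. These are the coefficients `(J, Q, I)` of its pullback by `A`: the pullback takes the
value `J x ^ 2 + Q x y + I y ^ 2` at a real vector `(x, y)`. -/
def formCoeff (A : SL(2, ℂ)) : ℝ × ℝ × ℝ :=
  ((A 0 0 * star (A 1 0)).im, (A 0 1 * star (A 1 0) + A 0 0 * star (A 1 1)).im,
    (A 0 1 * star (A 1 1)).im)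

lemma formCoeff_real_mul (P : SL(2, ℝ)) (A : SL(2, ℂ)) :
    formCoeff (SpecialLinearGroup.map Complex.ofRealHom P * A) = formCoeff A := by
  have hdet := P.det_coe
  rw [Matrix.det_fin_two] at hdet
  have e : ∀ i j, (SpecialLinearGroup.map Complex.ofRealHom P) i j = ((P i j : ℝ) : ℂ) :=
    fun i j => rfl
  simp only [formCoeff, mul_coe, e, Prod.mk.injEq]
  refine ⟨?_, ?_, ?_⟩ <;>
    simp only [Complex.mul_im, Complex.mul_re, Complex.add_im, Complex.add_re, Complex.star_def,
      Complex.conj_re, Complex.conj_im, Complex.ofReal_re, Complex.ofReal_im]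
  · linear_combination ((A 0 0).im * (A 1 0).re - (A 0 0).re * (A 1 0).im) * hdet
  · linear_combination ((A 0 1).im * (A 1 0).re - (A 0 1).re * (A 1 0).im
      + (A 0 0).im * (A 1 1).re - (A 0 0).re * (A 1 1).im) * hdet
  · linear_combination ((A 0 1).im * (A 1 1).re - (A 0 1).re * (A 1 1).im) * hdet

lemma formCoeff_mul_center (A : SL(2, ℂ)) {g : SL(2, ℂ)} (hg : g ∈ Subgroup.center SL(2, ℂ)) :
    formCoeff (A * g) = formCoeff A := by
  obtain ⟨r, hr, hrg⟩ := Matrix.SpecialLinearGroup.mem_center_iff.1 hg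
  have h00 : g 0 0 = r := by rw [← hrg]; simp
  have h01 : g 0 1 = 0 := by rw [← hrg]; simp
  have h10 : g 1 0 = 0 := by rw [← hrg]; simp
  have h11 : g 1 1 = r := by rw [← hrg]; simp
  have hr2 : r * star r = 1 := by
    have h1 : ‖r‖ ^ 2 = 1 := by rw [← norm_pow]; simpa using congrArg norm hr
    change r * (starRingEnd ℂ) r = 1
    rw [Complex.mul_conj, Complex.normSq_eq_norm_sq, h1]; simp
  simp only [formCoeff, mul_coe, h00, h01, h10, h11, mul_zero, add_zero, zero_add, star_mul']
  have key : ∀ x y : ℂ, x * r * (star y * star r) = x * star y := fun x y => by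
    linear_combination (x * star y) * hr2
  simp only [key]

lemma formCoeff_mul_nMat (A : SL(2, ℂ)) (z : ℂ) :
    formCoeff (A * nMat z) = ((formCoeff A).1 + ((A 0 1 * star (A 1 0)) * z
        + A 0 0 * star (A 1 1) * star z).im + Complex.normSq z * (formCoeff A).2.2,
      (formCoeff A).2.1 + 2 * z.re * (formCoeff A).2.2, (formCoeff A).2.2) := by
  have e00 : nMat z 0 0 = 1 := rfl
  have e01 : nMat z 0 1 = 0 := rfl
  have e10 : nMat z 1 0 = z := rfl
  have e11 : nMat z 1 1 = 1 := rfl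
  simp only [formCoeff, mul_coe, e00, e01, e10, e11, Prod.mk.injEq, Complex.normSq_apply]
  refine ⟨?_, ?_, ?_⟩ <;>
    simp only [Complex.mul_im, Complex.mul_re, Complex.add_im, Complex.add_re, Complex.star_def,
      Complex.conj_re, Complex.conj_im, mul_one, mul_zero, zero_add] <;> ring

/-- Along `t ↦ A n_t`, the coefficient `I` is constant, `Q` is affine and `J` is
quadratic in `t`. -/
lemma formCoeff_mul_u (A : SL(2, ℂ)) (t : ℝ) :
    formCoeff (A * nMat t) =
      ((formCoeff A).1 + t * (formCoeff A).2.1 + t ^ 2 * (formCoeff A).2.2,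
      (formCoeff A).2.1 + 2 * t * (formCoeff A).2.2, (formCoeff A).2.2) := by
  rw [formCoeff_mul_nMat]
  simp only [formCoeff, Prod.mk.injEq, and_true, Complex.ofReal_re]
  simp only [Complex.mul_im, Complex.mul_re, Complex.add_im, Complex.star_def,
    Complex.conj_re, Complex.conj_im, Complex.ofReal_re, Complex.ofReal_im, Complex.normSq_ofReal]
  ring

lemma formCoeff_mul_aMat (A : SL(2, ℂ)) (s : ℝ) :
    (formCoeff (A * aMat s)).2 = ((formCoeff A).2.1, Real.exp (-s) * (formCoeff A).2.2) := by
  have e00 : aMat s 0 0 = (Real.exp (s / 2) : ℂ) := rfl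
  have e01 : aMat s 0 1 = 0 := rfl
  have e10 : aMat s 1 0 = 0 := rfl
  have e11 : aMat s 1 1 = (Real.exp (-(s / 2)) : ℂ) := rfl
  have h1 : Real.exp (s / 2) * Real.exp (-(s / 2)) = 1 := by rw [← Real.exp_add]; simp
  have h2 : Real.exp (-s) = Real.exp (-(s / 2)) * Real.exp (-(s / 2)) := by
    rw [← Real.exp_add]; ring_nf
  rw [h2]
  simp only [formCoeff, mul_coe, e00, e01, e10, e11, Prod.mk.injEq]
  generalize Real.exp (s / 2) = p at *
  generalize Real.exp (-(s / 2)) = q at *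
  constructor <;>
    simp only [Complex.mul_im, Complex.mul_re, Complex.add_im, Complex.star_def,
      Complex.conj_re, Complex.conj_im, mul_zero, add_zero, zero_add,
      Complex.ofReal_re, Complex.ofReal_im]
  · linear_combination ((A 0 1).im * (A 1 0).re - (A 0 1).re * (A 1 0).im
      + (A 0 0).im * (A 1 1).re - (A 0 0).re * (A 1 1).im) * h1
  · ring

lemma formCoeff_mul_mMat (A : SL(2, ℂ)) (θ : ℝ) :
    (formCoeff (A * mMat θ)).2 =
      ((Complex.exp ((2 * θ : ℝ) * Complex.I) *
        (A 0 0 * star (A 1 1) - star (A 0 1) * A 1 0)).im, (formCoeff A).2.2) := by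
  have e00 : mMat θ 0 0 = Complex.exp (θ * Complex.I) := rfl
  have e01 : mMat θ 0 1 = 0 := rfl
  have e10 : mMat θ 1 0 = 0 := rfl
  have e11 : mMat θ 1 1 = Complex.exp (-(θ * Complex.I)) := rfl
  have hs : star (Complex.exp (θ * Complex.I)) = Complex.exp (-(θ * Complex.I)) := by
    rw [Complex.star_def, ← Complex.exp_conj]; simp
  have hs' : star (Complex.exp (-(θ * Complex.I))) = Complex.exp (θ * Complex.I) := by
    rw [← hs, star_star]
  have h1 : Complex.exp ((2 * θ : ℝ) * Complex.I) =
      Complex.exp (θ * Complex.I) * Complex.exp (θ * Complex.I) := by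
    rw [← Complex.exp_add]; push_cast; ring_nf
  have h2 : Complex.exp (θ * Complex.I) * Complex.exp (-(θ * Complex.I)) = 1 := by
    rw [← Complex.exp_add]; simp
  simp only [formCoeff, mul_coe, e00, e01, e10, e11, mul_zero, add_zero, zero_add, star_mul', hs,
    hs', h1, Prod.mk.injEq]
  generalize Complex.exp (θ * Complex.I) = p at *
  generalize Complex.exp (-(θ * Complex.I)) = q at *
  constructor
  · have : (A 0 1 * q * (star (A 1 0) * q)).im = -((star (A 0 1) * A 1 0) * (p * p)).im := by
      rw [← Complex.conj_im, ← Complex.star_def]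
      simp only [star_mul', star_star, hs]
      ring_nf
    rw [Complex.add_im, this, ← sub_eq_neg_add, ← Complex.sub_im]
    ring_nf
  · congr 1
    linear_combination (A 0 1 * star (A 1 1)) * h2

/-- The number `a d̄ - b̄ c` is `d̄ / d` or `b̄ / b` when `b / d` is real or infinite. -/
lemma coeff_ne_zero (A : SL(2, ℂ)) (hI : (formCoeff A).2.2 = 0) :
    A 0 0 * star (A 1 1) - star (A 0 1) * A 1 0 ≠ 0 := by
  intro hw
  have hdet := A.det_coe
  rw [Matrix.det_fin_two] at hdet
  have hr : star (A 0 1) * A 1 1 = A 0 1 * star (A 1 1) := by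
    have := Complex.conj_eq_iff_im.2 hI
    rw [← this, ← Complex.star_def, star_mul', star_star]
  have hd : star (A 1 1) = 0 := by
    linear_combination (A 1 1) * hw - star (A 1 1) * hdet + A 1 0 * hr
  have hb : star (A 0 1) = 0 := by
    linear_combination (A 0 1) * hw - star (A 0 1) * hdet + A 0 0 * hr
  rw [star_eq_zero] at hd hb
  simp [hd, hb] at hdet

/-! ### Distance to a geodesic plane -/

/-- The ratio `Im z / y`, the signed hyperbolic sine of the distance from `z + j y` to the
geodesic plane `Im z = 0`. -/
def slope (p : H3) : ℝ := p.z.im / p.y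

lemma slope_act (A : SL(2, ℂ)) (p : H3) : slope (act A p) = (num A p).im / p.y := by
  have hD := (den_pos A p).ne'
  have : (act A p).z = num A p / (den A p : ℂ) := rfl
  have hy : (act A p).y = p.y / den A p := rfl
  rw [slope, this, hy, Complex.div_ofReal_im]
  have := p.pos.ne'
  field_simp

lemma num_im (A : SL(2, ℂ)) (p : H3) :
    (num A p).im = (Complex.normSq p.z + p.y ^ 2) * (formCoeff A).1
      + (A 0 1 * star (A 1 0) * star p.z + A 0 0 * star (A 1 1) * p.z).im
      + (formCoeff A).2.2 := by
  simp only [num, formCoeff, Complex.normSq_apply, ← Complex.ofReal_pow]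
  simp only [Complex.mul_im, Complex.mul_re, Complex.add_im, Complex.add_re, Complex.star_def,
    Complex.conj_re, Complex.conj_im, Complex.ofReal_re, Complex.ofReal_im]
  ring

lemma slope_act_o (A : SL(2, ℂ)) : slope (act A o) = (formCoeff A).1 + (formCoeff A).2.2 := by
  rw [slope_act, num_im]
  simp [o]

lemma slope_real_act (P : SL(2, ℝ)) (p : H3) :
    slope (act (SpecialLinearGroup.map Complex.ofRealHom P) p) = slope p := by
  have hdet := P.det_coe
  rw [Matrix.det_fin_two] at hdet
  have e : ∀ i j, (SpecialLinearGroup.map Complex.ofRealHom P) i j = ((P i j : ℝ) : ℂ) :=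
    fun i j => rfl
  rw [slope_act, slope]
  congr 1
  simp only [num, e, ← Complex.ofReal_pow]
  simp only [Complex.mul_im, Complex.mul_re, Complex.add_im, Complex.add_re, Complex.star_def,
    Complex.conj_re, Complex.conj_im, Complex.ofReal_re, Complex.ofReal_im]
  linear_combination p.z.im * hdet

/-- The quantity `|z - z'| ^ 2 + y ^ 2 + y' ^ 2`, which is `2 y y' cosh d`, is transformed by `act`
like `y y'`. -/
lemma coshNum_act (A : SL(2, ℂ)) (p q : H3) :
    (‖(act A p).z - (act A q).z‖ ^ 2 + (act A p).y ^ 2 + (act A q).y ^ 2) * (den A p * den A q) =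
      ‖p.z - q.z‖ ^ 2 + p.y ^ 2 + q.y ^ 2 := by
  have hP : (den A p : ℂ) ≠ 0 := by exact_mod_cast (den_pos A p).ne'
  have hQ : (den A q : ℂ) ≠ 0 := by exact_mod_cast (den_pos A q).ne'
  have hdet := A.det_coe
  rw [Matrix.det_fin_two] at hdet
  have hdet' := congrArg star hdet
  simp only [star_sub, star_mul', star_one] at hdet'
  have kp := den_cast A p
  have kq := den_cast A q
  have np := act_normSq A p
  have nq := act_normSq A q
  have hnorm : ∀ w : ℂ, ((‖w‖ ^ 2 : ℝ) : ℂ) = w * star w := fun w => by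
    rw [Complex.star_def, Complex.mul_conj, Complex.normSq_eq_norm_sq]
  have hzp : (act A p).z = num A p / (den A p : ℂ) := rfl
  have hzq : (act A q).z = num A q / (den A q : ℂ) := rfl
  have hyp : (((act A p).y : ℝ) : ℂ) = p.y / den A p := by simp [act]
  have hyq : (((act A q).y : ℝ) : ℂ) = q.y / den A q := by simp [act]
  have hs : ∀ x : ℝ, star (x : ℂ) = x := fun x => by simp
  rw [← Complex.ofReal_inj]
  simp only [Complex.ofReal_mul, Complex.ofReal_add, hnorm, Complex.ofReal_pow p.y,
    Complex.ofReal_pow q.y, Complex.ofReal_pow (act A p).y, Complex.ofReal_pow (act A q).y, hzp,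
    hzq, hyp, hyq, star_sub, star_div₀, hs]
  have expand : ∀ n m D E y x : ℂ, D ≠ 0 → E ≠ 0 →
      ((n / D - m / E) * (star n / D - star m / E) + (y / D) ^ 2 + (x / E) ^ 2) * (D * E) =
        (n * star n + y ^ 2) / D * E + (m * star m + x ^ 2) / E * D
          - (n * star m + m * star n) := by
    intro n m D E y x hD hE
    field_simp
    ring
  rw [expand _ _ _ _ _ _ hP hQ, np, nq, mul_div_cancel_right₀ _ hP, mul_div_cancel_right₀ _ hQ,
    kp, kq]
  simp only [num, star_add, star_mul', star_star, star_pow, hs]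
  linear_combination ((star (A 0 0) * star (A 1 1) - star (A 0 1) * star (A 1 0)) * hdet + hdet')
    * ((p.z - q.z) * (star p.z - star q.z) + (p.y : ℂ) ^ 2 + (q.y : ℂ) ^ 2)

lemma hdist_eq (p q : H3) :
    hdist p q = Real.arcosh ((‖p.z - q.z‖ ^ 2 + p.y ^ 2 + q.y ^ 2) / (2 * p.y * q.y)) := by
  have hp := p.pos.ne'
  have hq := q.pos.ne'
  rw [hdist]
  congr 1
  field_simp
  ring

lemma hdist_act (A : SL(2, ℂ)) (p q : H3) : hdist (act A p) (act A q) = hdist p q := by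
  rw [hdist_eq, hdist_eq, ← coshNum_act A p q]
  congr 1
  have hp := p.pos.ne'
  have hq := q.pos.ne'
  have hP := (den_pos A p).ne'
  have hQ := (den_pos A q).ne'
  have hyp : (act A p).y = p.y / den A p := rfl
  have hyq : (act A q).y = q.y / den A q := rfl
  rw [hyp, hyq]
  field_simp

lemma toPSL_surjective : Function.Surjective toPSL := QuotientGroup.mk'_surjective _

lemma hdist_smul (g : G) (p q : H3) : hdist (g • p) (g • q) = hdist p q := by
  obtain ⟨A, rfl⟩ := toPSL_surjective g
  exact hdist_act A p q

lemma arcosh_abs_slope_le_hdist (p q : H3) (hq : q.z.im = 0) (hp : 0 < |slope p|) :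
    Real.arcosh |slope p| ≤ hdist p q := by
  have hy := p.pos
  have hy' := q.pos
  have hle : |slope p| ≤ (‖p.z - q.z‖ ^ 2 + p.y ^ 2 + q.y ^ 2) / (2 * p.y * q.y) := by
    rw [slope, abs_div, abs_of_pos hy, div_le_div_iff₀ hy (by positivity)]
    -- Minimizing over the real point `q.z`, then over `q.y` by the inequality of the means.
    have h1 : |p.z.im| ^ 2 ≤ ‖p.z - q.z‖ ^ 2 := by
      have := Complex.abs_im_le_norm (p.z - q.z)
      rw [Complex.sub_im, hq, sub_zero] at this
      gcongr
    have h2 : 2 * q.y * |p.z.im| ≤ ‖p.z - q.z‖ ^ 2 + p.y ^ 2 + q.y ^ 2 := by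
      nlinarith [sq_nonneg (q.y - |p.z.im|), sq_nonneg p.y]
    nlinarith [mul_le_mul_of_nonneg_right h2 hy.le]
  rw [hdist_eq]
  exact (Real.arcosh_le_arcosh hp (hp.trans_le hle)).2 hle

lemma arcosh_abs_slope_le_planeDist (h g : G) (hp : 0 < |slope ((h⁻¹ * g) • o)|) :
    Real.arcosh |slope ((h⁻¹ * g) • o)| ≤ planeDist h g := by
  -- The infimum in `planeDist` runs over a non-empty set, so that it is not the junk value `0`.
  have : Nonempty {p : H3 // p.z.im = 0} := ⟨⟨o, by simp [o]⟩⟩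
  refine le_ciInf fun p => ?_
  have := hdist_smul h ((h⁻¹ * g) • o) p
  rw [smul_smul, mul_inv_cancel_left] at this
  rw [this]
  exact arcosh_abs_slope_le_hdist _ _ p.2 hp

lemma tendsto_arcosh_atTop : Tendsto Real.arcosh atTop atTop := by
  refine tendsto_atTop_mono' _ ?_ Real.tendsto_log_atTop
  filter_upwards [eventually_gt_atTop 0] with x hx
  exact Real.log_le_log hx (le_add_of_nonneg_right (Real.sqrt_nonneg _))

lemma tendsto_planeDist {α : Type*} {l : Filter α} (h : G) (f : α → G)
    (hf : Tendsto (fun t => |slope ((h⁻¹ * f t) • o)|) l atTop) :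
    Tendsto (fun t => planeDist h (f t)) l atTop := by
  refine tendsto_atTop_mono' _ ?_ (tendsto_arcosh_atTop.comp hf)
  filter_upwards [hf.eventually_gt_atTop 0] with t ht
  exact arcosh_abs_slope_le_planeDist h (f t) ht

lemma slope_smul_of_mem_PSL2R {g : G} (hg : g ∈ PSL2R) (p : H3) : slope (g • p) = slope p := by
  obtain ⟨P, rfl⟩ := hg
  exact slope_real_act P p

/-! ### The form on `G` and on `Γ \ G` -/

/-- The coefficients `formCoeff`, as functions on `G = PSL₂(ℂ)`. -/
def planeForm (g : G) : ℝ × ℝ × ℝ :=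
  Quotient.lift formCoeff (fun A B hAB => by
    have hc : A⁻¹ * B ∈ Subgroup.center SL(2, ℂ) := QuotientGroup.leftRel_apply.1 hAB
    rw [← formCoeff_mul_center A hc, mul_inv_cancel_left]) g

lemma planeForm_toPSL (A : SL(2, ℂ)) : planeForm (toPSL A) = formCoeff A := rfl

lemma continuous_planeForm : Continuous planeForm := by
  refine Continuous.quotient_lift ?_ _
  unfold formCoeff
  have h : ∀ i j, Continuous fun A : SL(2, ℂ) => A i j := fun i j =>
    (continuous_apply_apply i j).comp continuous_subtype_val
  have := h 0 0
  have := h 0 1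
  have := h 1 0
  have := h 1 1
  fun_prop

lemma planeForm_mul_of_mem_PSL2R {p : G} (hp : p ∈ PSL2R) (g : G) :
    planeForm (p * g) = planeForm g := by
  obtain ⟨P, rfl⟩ := hp
  obtain ⟨A, rfl⟩ := toPSL_surjective g
  exact formCoeff_real_mul P A

lemma planeForm_mul_u (g : G) (t : ℝ) :
    planeForm (g * u t) = ((planeForm g).1 + t * (planeForm g).2.1 + t ^ 2 * (planeForm g).2.2,
      (planeForm g).2.1 + 2 * t * (planeForm g).2.2, (planeForm g).2.2) := by
  obtain ⟨A, rfl⟩ := toPSL_surjective g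
  exact formCoeff_mul_u A t

lemma slope_smul_o (g : G) : slope (g • o) = (planeForm g).1 + (planeForm g).2.2 := by
  obtain ⟨A, rfl⟩ := toPSL_surjective g
  exact slope_act_o A

lemma exists_continuous_planeForm_proj (Γ : Subgroup G) (h : G)
    (hh : ∀ γ ∈ Γ, h⁻¹ * γ * h ∈ PSL2R) :
    ∃ f : X Γ → ℝ × ℝ × ℝ, Continuous f ∧ ∀ g, f (proj Γ g) = planeForm (h⁻¹ * g) := by
  have hc : Continuous fun g : G => planeForm (h⁻¹ * g) :=
    continuous_planeForm.comp (continuous_const_mul _)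
  refine ⟨Quotient.lift (fun g : G => planeForm (h⁻¹ * g)) ?_, hc.quotient_lift _, fun g => rfl⟩
  rintro a b ⟨γ, rfl⟩
  have := planeForm_mul_of_mem_PSL2R (hh γ γ.2) (h⁻¹ * b)
  rw [← this]
  congr 1
  simp only [Subgroup.smul_def, smul_eq_mul]
  group

/-! ### The limit set lies on a circle -/

/-- The condition `I = 0` for `A k_ξ` says that `A ξ` is real or infinite. The points `z + j y` of an
orbit of `Γ` are mapped by `A` to points of one and the same slope `c`, so that the pulled back form
equals `c y` along the orbit; at an accumulation point in the boundary, `y = 0` makes it vanish. -/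
lemma limitSet_subset (Γ : Subgroup G) (A : SL(2, ℂ))
    (hA : ∀ γ ∈ Γ, (toPSL A) * γ * (toPSL A)⁻¹ ∈ PSL2R) :
    limitSet Γ ⊆ {ξ | (formCoeff (A * kMat ξ)).2.2 = 0} := by
  rintro ξ ⟨p, hp⟩
  set c := slope (act A p) with hc
  -- `F (z, y)` is the difference of the pulled back form and `c y`, as a function on `ℂ × ℝ`.
  set F : ℂ × ℝ → ℝ := fun x => (Complex.normSq x.1 + x.2 ^ 2) * (formCoeff A).1
      + (A 0 1 * star (A 1 0) * star x.1 + A 0 0 * star (A 1 1) * x.1).im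
      + (formCoeff A).2.2 - c * x.2 with hF
  have hFc : Continuous F := by
    have := Complex.continuous_normSq
    fun_prop
  have horb : ∀ γ : Γ, F ((((γ : G) • p).z, ((γ : G) • p).y)) = 0 := by
    intro γ
    have h1 : slope (act A ((γ : G) • p)) = c := by
      have := slope_smul_of_mem_PSL2R (hA γ γ.2) ((toPSL A) • p)
      rw [← mul_smul, inv_mul_cancel_right, mul_smul] at this
      exact this
    rw [slope_act, num_im, div_eq_iff ((γ : G) • p).pos.ne'] at h1
    simp only [hF, h1, sub_self]
  set S : Set (ℂ × ℝ) := {x | F x = 0} with hS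
  have hsub : (Set.range fun γ : Γ => ((γ : G) • p).toClosure) ⊆
      ((↑) : ℂ × ℝ → OnePoint (ℂ × ℝ)) '' S := by
    rintro _ ⟨γ, rfl⟩
    exact ⟨_, horb γ, rfl⟩
  have hacc : AccPt (Bd.toClosure ξ) (𝓟 (((↑) : ℂ × ℝ → OnePoint (ℂ × ℝ)) '' S)) :=
    hp.mono (principal_mono.2 hsub)
  induction ξ using OnePoint.rec with
  | infty =>
    have hval : (formCoeff (A * kMat OnePoint.infty)).2.2 = (formCoeff A).1 := by
      have e01 : kMat OnePoint.infty 0 1 = 1 := rfl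
      have e11 : kMat OnePoint.infty 1 1 = 0 := rfl
      simp [formCoeff, mul_coe, e01, e11]
    show (formCoeff (A * kMat OnePoint.infty)).2.2 = 0
    rw [hval]
    by_contra hne
    -- `F` grows quadratically, so that its zero set is bounded.
    have hbdd : S ⊆ Metric.closedBall 0 ((‖A 0 1 * star (A 1 0)‖ + ‖A 0 0 * star (A 1 1)‖
        + |(formCoeff A).2.2| + |c|) / |(formCoeff A).1| + 1) := by
      intro x hx
      rw [mem_closedBall_zero_iff]
      by_contra! hlt
      have hpos := abs_pos.2 hne
      set n := ‖x‖ with hn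
      have hx1 : ‖x.1‖ ≤ n := norm_fst_le x
      have hx2 : |x.2| ≤ n := norm_snd_le x
      have hn1 : 1 < n := lt_of_le_of_lt (le_add_of_nonneg_left (by positivity)) hlt
      have hK := (div_lt_iff₀ hpos).1 (lt_sub_iff_add_lt.2 hlt)
      have hquad : n ^ 2 ≤ Complex.normSq x.1 + x.2 ^ 2 := by
        rw [Complex.normSq_eq_norm_sq]
        rcases max_choice ‖x.1‖ ‖x.2‖ with h | h
        · rw [hn, Prod.norm_def, h]
          nlinarith [sq_nonneg x.2]
        · rw [hn, Prod.norm_def, h, Real.norm_eq_abs, sq_abs]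
          nlinarith [sq_nonneg ‖x.1‖]
      have hlin : |(A 0 1 * star (A 1 0) * star x.1 + A 0 0 * star (A 1 1) * x.1).im| ≤
          (‖A 0 1 * star (A 1 0)‖ + ‖A 0 0 * star (A 1 1)‖) * n := by
        refine (Complex.abs_im_le_norm _).trans ((norm_add_le _ _).trans ?_)
        rw [norm_mul _ (star x.1), norm_mul _ x.1, norm_star, ← add_mul]
        gcongr
      have hx0 : (Complex.normSq x.1 + x.2 ^ 2) * (formCoeff A).1 =
          c * x.2 - (formCoeff A).2.2
          - (A 0 1 * star (A 1 0) * star x.1 + A 0 0 * star (A 1 1) * x.1).im := by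
        have : F x = 0 := hx
        simp only [hF] at this
        linarith
      have habs := congrArg abs hx0
      rw [abs_mul, abs_of_nonneg (le_trans (sq_nonneg n) hquad)] at habs
      have hup : |c * x.2 - (formCoeff A).2.2
          - (A 0 1 * star (A 1 0) * star x.1 + A 0 0 * star (A 1 1) * x.1).im| ≤
          |c| * n + |(formCoeff A).2.2|
            + (‖A 0 1 * star (A 1 0)‖ + ‖A 0 0 * star (A 1 1)‖) * n := by
        refine (abs_sub _ _).trans (add_le_add ((abs_sub _ _).trans ?_) hlin)
        rw [abs_mul]
        gcongr
      have h1 := mul_le_mul_of_nonneg_right hquad hpos.le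
      have h2 := mul_lt_mul_of_pos_right hK (zero_lt_one.trans hn1)
      nlinarith [abs_nonneg (formCoeff A).2.2]
    have hcomp : IsCompact S :=
      (isCompact_closedBall _ _).of_isClosed_subset (isClosed_singleton.preimage hFc) hbdd
    have hfreq := accPt_iff_frequently.1 hacc
    refine hfreq ?_
    have : Bd.toClosure OnePoint.infty = OnePoint.infty := rfl
    rw [this]
    filter_upwards [(OnePoint.isOpen_compl_image_coe.2 ⟨hcomp.isClosed, hcomp⟩).mem_nhds
      OnePoint.infty_notMem_image_coe] with y hy hy'
    exact hy hy'.2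
  | coe w =>
    have hval : (formCoeff (A * kMat w)).2.2 =
        F (w, 0) * (√(1 + Complex.normSq w))⁻¹ ^ 2 := by
      have e01 : kMat w 0 1 = w * ((√(1 + Complex.normSq w))⁻¹ : ℂ) := rfl
      have e11 : kMat w 1 1 = ((√(1 + Complex.normSq w))⁻¹ : ℂ) := rfl
      simp only [hF, formCoeff, mul_coe, e01, e11, ← Complex.ofReal_inv]
      generalize (√(1 + Complex.normSq w))⁻¹ = r
      simp only [Complex.mul_im, Complex.mul_re, Complex.add_im, Complex.add_re, Complex.star_def,
        Complex.conj_re, Complex.conj_im, Complex.ofReal_re, Complex.ofReal_im,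
        Complex.normSq_apply]
      ring
    show (formCoeff (A * kMat w)).2.2 = 0
    have hw : ((w, (0 : ℝ)) : ℂ × ℝ) ∈ closure S := by
      rw [mem_closure_iff_frequently]
      have h1 := (accPt_iff_frequently.1 hacc).mono fun y hy => hy.2
      have : Bd.toClosure (w : Bd) = (((w, (0 : ℝ)) : ℂ × ℝ) : OnePoint (ℂ × ℝ)) := rfl
      rw [this, OnePoint.nhds_coe_eq, frequently_map] at h1
      exact h1.mono fun y hy => (OnePoint.coe_injective.mem_set_image).1 hy
    have hw0 : F (w, 0) = 0 := (isClosed_eq hFc continuous_const).closure_subset hw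
    rw [hval, hw0, zero_mul]

/-! ### The Burger–Roblin measure in Iwasawa coordinates -/

instance : SecondCountableTopology SL(2, ℂ) :=
  haveI : SecondCountableTopology (Matrix (Fin 2) (Fin 2) ℂ) :=
    inferInstanceAs (SecondCountableTopology (Fin 2 → Fin 2 → ℂ))
  SpecialLinearGroup.isClosedEmbedding_val.isEmbedding.secondCountableTopology

instance : SecondCountableTopology G := QuotientGroup.instSecondCountableTopology _

lemma continuous_toPSL : Continuous toPSL := QuotientGroup.continuous_mk

lemma continuous_SL_mk {α : Type*} [TopologicalSpace α] {f : α → SL(2, ℂ)}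
    (h : ∀ i j, Continuous fun x => f x i j) : Continuous f :=
  continuous_induced_rng.2 (continuous_matrix h)

lemma continuous_kMat_coe : Continuous fun w : ℂ => kMat (w : Bd) := by
  have hs : Continuous fun w : ℂ => (((√(1 + Complex.normSq w) : ℝ) : ℂ))⁻¹ := by
    refine Continuous.inv₀ ?_ fun w => ?_
    · have := Complex.continuous_normSq
      fun_prop
    · have := Complex.normSq_nonneg w
      exact_mod_cast (Real.sqrt_pos.2 (by positivity)).ne'
  refine continuous_SL_mk fun i j => ?_
  fin_cases i <;> fin_cases j
  · exact hs
  · exact continuous_id.mul hs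
  · exact continuous_star.neg.mul hs
  · exact hs

lemma continuous_mMat : Continuous mMat := by
  refine continuous_SL_mk fun i j => ?_
  fin_cases i <;> fin_cases j <;> simp [mMat] <;> fun_prop

lemma continuous_aMat : Continuous aMat := by
  refine continuous_SL_mk fun i j => ?_
  fin_cases i <;> fin_cases j <;> simp [aMat] <;> fun_prop

lemma continuous_nMat : Continuous nMat := by
  refine continuous_SL_mk fun i j => ?_
  fin_cases i <;> fin_cases j <;> simp [nMat] <;> fun_prop

lemma measurable_iwasawa : Measurable iwasawa := by
  have hm := continuous_mMat
  have ha := continuous_aMat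
  have hn := continuous_nMat
  have hk := continuous_kMat_coe
  have hp := continuous_toPSL
  have h1 : Continuous fun q : ℝ × ℝ × ℂ => iwasawa (OnePoint.infty, q) :=
    hp.comp (((continuous_const.mul (hm.comp continuous_fst)).mul
      (ha.comp continuous_snd.fst)).mul (hn.comp continuous_snd.snd))
  have h2 : Continuous fun q : ℂ × ℝ × ℝ × ℂ => iwasawa ((q.1 : Bd), q.2) :=
    hp.comp ((((hk.comp continuous_fst).mul (hm.comp continuous_snd.fst)).mul
      (ha.comp continuous_snd.snd.fst)).mul (hn.comp continuous_snd.snd.snd))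
  have he : MeasurableEmbedding (Prod.map ((↑) : ℂ → Bd) (id : ℝ × ℝ × ℂ → ℝ × ℝ × ℂ)) :=
    OnePoint.isOpenEmbedding_coe.measurableEmbedding.prodMap MeasurableEmbedding.id
  refine measurable_of_isOpen fun V hV => ?_
  have hset : iwasawa ⁻¹' V =
      ({(OnePoint.infty : Bd)} ×ˢ ((fun q : ℝ × ℝ × ℂ => iwasawa (OnePoint.infty, q)) ⁻¹' V)) ∪
      (Prod.map ((↑) : ℂ → Bd) (id : ℝ × ℝ × ℂ → ℝ × ℝ × ℂ)) ''
        ((fun q : ℂ × ℝ × ℝ × ℂ => iwasawa ((q.1 : Bd), q.2)) ⁻¹' V) := by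
    ext ⟨ξ, q⟩
    induction ξ using OnePoint.rec with
    | infty => simp
    | coe w => simp
  rw [hset]
  exact ((measurableSet_singleton _).prod (hV.preimage h1).measurableSet).union
    (he.measurableSet_image.2 (hV.preimage h2).measurableSet)

/-- If `A ξ` is real or infinite, then the form of `A k_ξ m_θ a_s n_z` has `I = 0`, and
its coefficient `Q` depends on `ξ` and `θ` only. -/
lemma formCoeff_mul_iwasawa (A : SL(2, ℂ)) (ξ : Bd) (hξ : (formCoeff (A * kMat ξ)).2.2 = 0) :
    ∃ w : ℂ, w ≠ 0 ∧ ∀ q : ℝ × ℝ × ℂ, (planeForm (toPSL A * iwasawa (ξ, q))).2 =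
      ((Complex.exp ((2 * q.1 : ℝ) * Complex.I) * w).im, 0) := by
  refine ⟨_, coeff_ne_zero _ hξ, fun q => ?_⟩
  rw [iwasawa, ← map_mul, planeForm_toPSL, ← mul_assoc, ← mul_assoc, ← mul_assoc,
    formCoeff_mul_nMat]
  have h1 := formCoeff_mul_mMat (A * kMat ξ) q.1
  rw [hξ] at h1
  have h2 := formCoeff_mul_aMat (A * kMat ξ * mMat q.1) q.2.1
  rw [h1, mul_zero] at h2
  rw [h2]
  simp only [mul_zero, add_zero]

lemma exp_mul_im (θ : ℝ) (w : ℂ) :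
    (Complex.exp ((2 * θ : ℝ) * Complex.I) * w).im = ‖w‖ * Real.sin (2 * θ + w.arg) := by
  conv_lhs => rw [← Complex.norm_mul_exp_arg_mul_I w]
  have : Complex.exp ((2 * θ : ℝ) * Complex.I) * (‖w‖ * Complex.exp (w.arg * Complex.I)) =
      ‖w‖ * Complex.exp ((2 * θ + w.arg : ℝ) * Complex.I) := by
    rw [mul_left_comm, ← Complex.exp_add, ← add_mul]
    push_cast
    rfl
  rw [this, Complex.im_ofReal_mul, Complex.exp_ofReal_mul_I_im]

lemma ae_exp_mul_im_ne_zero {w : ℂ} (hw : w ≠ 0) :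
    ∀ᵐ θ : ℝ, (Complex.exp ((2 * θ : ℝ) * Complex.I) * w).im ≠ 0 := by
  -- The zeros of `sin (2 θ + arg w)` are countably many.
  have hcount : (Set.range fun n : ℤ => (n * Real.pi - w.arg) / 2).Countable :=
    Set.countable_range _
  refine (measure_mono_null ?_ (hcount.measure_zero volume) :)
  intro θ hθ
  have h0 : (Complex.exp ((2 * θ : ℝ) * Complex.I) * w).im = 0 := not_not.1 hθ
  rw [exp_mul_im] at h0
  obtain ⟨n, hn⟩ := Real.sin_eq_zero_iff.1 ((mul_eq_zero.1 h0).resolve_left (norm_ne_zero_iff.2 hw))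
  exact ⟨n, by simp only [hn]; ring⟩

/-- With `ε = ± 1`: both signs of `Im (e ^ (2 i θ) w)` occur on a set of angles of positive
measure. -/
lemma not_ae_exp_mul_im_nonpos {w : ℂ} (hw : w ≠ 0) {ε : ℝ} (hε : ε = 1 ∨ ε = -1) :
    ¬ ∀ᵐ θ ∂(volume.restrict (Set.Ico 0 (2 * Real.pi))),
      ¬ 0 < ε * (Complex.exp ((2 * θ : ℝ) * Complex.I) * w).im := by
  intro hae
  rw [ae_restrict_iff' measurableSet_Ico] at hae
  set T : Set ℝ := Set.Ioo 0 (2 * Real.pi) ∩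
    {θ | 0 < ε * (Complex.exp ((2 * θ : ℝ) * Complex.I) * w).im} with hT
  have hopen : IsOpen T := by
    refine isOpen_Ioo.inter (isOpen_lt continuous_const ?_)
    fun_prop
  have hne : T.Nonempty := by
    have hpi := Real.pi_pos
    have h1 := Complex.neg_pi_lt_arg w
    have h2 := Complex.arg_le_pi w
    have hn := norm_pos_iff.2 hw
    rcases hε with rfl | rfl
    · refine ⟨(Real.pi / 2 - w.arg) / 2 + Real.pi, ⟨by linarith, by linarith⟩, ?_⟩
      have : 2 * ((Real.pi / 2 - w.arg) / 2 + Real.pi) + w.arg = Real.pi / 2 + 2 * Real.pi := by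
        ring
      rw [Set.mem_ofPred_eq, exp_mul_im, this, Real.sin_add_two_pi, Real.sin_pi_div_two]
      simpa using hw
    · refine ⟨(-(Real.pi / 2) - w.arg) / 2 + Real.pi, ⟨by linarith, by linarith⟩, ?_⟩
      have : 2 * ((-(Real.pi / 2) - w.arg) / 2 + Real.pi) + w.arg =
          -(Real.pi / 2) + 2 * Real.pi := by
        ring
      rw [Set.mem_ofPred_eq, exp_mul_im, this, Real.sin_add_two_pi, Real.sin_neg,
        Real.sin_pi_div_two]
      simpa using hw
  refine (hopen.measure_pos volume hne).ne' (measure_mono_null ?_ hae)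
  intro θ hθ hθ'
  exact hθ' ⟨hθ.1.1.le, hθ.1.2⟩ hθ.2

/-- The hypothesis says that `h⁻¹ ξ` is real or infinite for `ν_o`-almost every `ξ`; then `Q` can
vanish for countably many angles `θ` only. -/
lemma ae_brLift (Γ : Subgroup G) (ν : H3 → Measure Bd) (h : G)
    (hν : ∀ A : SL(2, ℂ), toPSL A = h⁻¹ → ∀ᵐ ξ ∂(ν o), (formCoeff (A * kMat ξ)).2.2 = 0) :
    ∀ᵐ g ∂(brLift Γ ν), (planeForm (h⁻¹ * g)).2.2 = 0 ∧ (planeForm (h⁻¹ * g)).2.1 ≠ 0 := by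
  obtain ⟨A, hA⟩ := toPSL_surjective h⁻¹
  have hc : Measurable fun g : G => planeForm (h⁻¹ * g) :=
    (continuous_planeForm.comp (continuous_const_mul _)).measurable
  have hm : MeasurableSet {g : G | (planeForm (h⁻¹ * g)).2.2 = 0 ∧
      (planeForm (h⁻¹ * g)).2.1 ≠ 0} :=
    (hc.snd.snd (measurableSet_singleton 0)).inter (hc.snd.fst (measurableSet_singleton 0).compl)
  have hm2 : MeasurableSet {q | (planeForm (h⁻¹ * iwasawa q)).2.2 = 0 ∧
      (planeForm (h⁻¹ * iwasawa q)).2.1 ≠ 0} := measurable_iwasawa hm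
  rw [brLift, ae_map_iff measurable_iwasawa.aemeasurable hm, Measure.ae_prod_iff_ae_ae hm2]
  filter_upwards [hν A hA] with ξ hξ
  obtain ⟨w, hw, hq⟩ := formCoeff_mul_iwasawa A ξ hξ
  rw [hA] at hq
  have hm3 : MeasurableSet {q | (planeForm (h⁻¹ * iwasawa (ξ, q))).2.2 = 0 ∧
      (planeForm (h⁻¹ * iwasawa (ξ, q))).2.1 ≠ 0} := measurable_prodMk_left hm2
  rw [Measure.ae_prod_iff_ae_ae hm3]
  refine Measure.ae_smul_measure (ae_restrict_of_ae ?_) _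
  filter_upwards [ae_exp_mul_im_ne_zero hw] with θ hθ
  refine Eventually.of_forall fun q => ?_
  simp only [hq]
  exact ⟨trivial, hθ⟩

/-- Each of the conditions `Q > 0` and `Q < 0`, together with `I = 0`, defines a set of positive
measure. -/
lemma brLift_ne_zero (Γ : Subgroup G) (ν : H3 → Measure Bd) (h : G) (h0 : ν o ≠ 0)
    (hν : ∀ A : SL(2, ℂ), toPSL A = h⁻¹ → ∀ᵐ ξ ∂(ν o), (formCoeff (A * kMat ξ)).2.2 = 0)
    {ε : ℝ} (hε : ε = 1 ∨ ε = -1) :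
    brLift Γ ν {g | (planeForm (h⁻¹ * g)).2.2 = 0 ∧ 0 < ε * (planeForm (h⁻¹ * g)).2.1} ≠ 0 := by
  intro hzero
  obtain ⟨A, hA⟩ := toPSL_surjective h⁻¹
  have hae : ∀ᵐ g ∂(brLift Γ ν),
      ¬ ((planeForm (h⁻¹ * g)).2.2 = 0 ∧ 0 < ε * (planeForm (h⁻¹ * g)).2.1) :=
    measure_eq_zero_iff_ae_notMem.1 hzero
  have h1 := Measure.ae_ae_of_ae_prod (ae_of_ae_map measurable_iwasawa.aemeasurable hae)
  have : (ae (ν o)).NeBot := ae_neBot.2 h0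
  obtain ⟨ξ, hξ, h2⟩ := ((hν A hA).and h1).exists
  obtain ⟨w, hw, hq⟩ := formCoeff_mul_iwasawa A ξ hξ
  rw [hA] at hq
  have h3 := Measure.ae_ae_of_ae_prod h2
  rw [Measure.ae_ennreal_smul_measure_iff (by simpa using Real.pi_pos)] at h3
  refine not_ae_exp_mul_im_nonpos hw hε ?_
  filter_upwards [h3] with θ hθ hpos
  have hne : (ae (volume.withDensity fun s : ℝ =>
      ENNReal.ofReal (Real.exp (-criticalExponent Γ * s)))).NeBot := by
    rw [ae_neBot, Ne, withDensity_eq_zero_iff (by fun_prop)]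
    intro hw0
    obtain ⟨s, hs⟩ := hw0.exists
    exact (ENNReal.ofReal_pos.2 (Real.exp_pos _)).ne' hs
  obtain ⟨s, hs⟩ := (Measure.ae_ae_of_ae_prod hθ).exists
  obtain ⟨z, hq'⟩ := hs.exists
  simp only [hq] at hq'
  exact hq' ⟨trivial, hpos⟩

/-! ### The induced measure -/

/-- The induced measure is a supremum of measures that vanish on `N`, hence is at most its own
restriction to the complement of `N`. -/
lemma inducedMeasure_eq_zero (Γ : Subgroup G) (μ : Measure G) {N : Set (X Γ)}
    (hN : MeasurableSet N) (h : μ (proj Γ ⁻¹' N) = 0) : inducedMeasure Γ μ N = 0 := by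
  have hπ : Measurable (proj Γ) := (continuous_proj Γ).measurable
  have hle : inducedMeasure Γ μ ≤ (inducedMeasure Γ μ).restrict Nᶜ := by
    refine iSup₂_le fun E hE => ?_
    have h1 : (μ.restrict E).map (proj Γ) ≤ inducedMeasure Γ μ :=
      le_iSup₂ (f := fun (E : Set G) (_ : MeasurableSet E ∧ Set.InjOn (proj Γ) E) =>
        (μ.restrict E).map (proj Γ)) E hE
    have h2 : ((μ.restrict E).map (proj Γ)).restrict Nᶜ = (μ.restrict E).map (proj Γ) := by
      refine Measure.restrict_eq_self_of_ae_mem ?_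
      refine measure_eq_zero_iff_ae_notMem.1 ?_
      rw [Measure.map_apply hπ hN]
      exact nonpos_iff_eq_zero.1 ((Measure.restrict_apply_le _ _).trans h.le)
    rw [← h2]
    exact Measure.restrict_mono le_rfl h1
  have := hle N
  rwa [Measure.restrict_apply hN, Set.inter_compl_self, measure_empty, nonpos_iff_eq_zero] at this

/-- Conversely, when `Γ` is discrete, `g ↦ Γ g` is locally injective, so that a null set of the
induced measure has a null preimage. -/
lemma measure_preimage_proj_eq_zero (Γ : Subgroup G) [DiscreteTopology Γ] (μ : Measure G)
    {N : Set (X Γ)} (hN : MeasurableSet N) (h : inducedMeasure Γ μ N = 0) :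
    μ (proj Γ ⁻¹' N) = 0 := by
  have hπ : Measurable (proj Γ) := (continuous_proj Γ).measurable
  obtain ⟨W, hW, hW1⟩ := isOpen_induced_iff.1 (isOpen_discrete ({1} : Set Γ))
  have h1W : (1 : G) ∈ W := by
    have : (1 : Γ) ∈ ((↑) : Γ → G) ⁻¹' W := hW1 ▸ Set.mem_singleton _
    exact this
  refine measure_null_of_locally_null _ fun g _ => ?_
  have hcont : Continuous fun x : G × G => x.1 * x.2⁻¹ := by fun_prop
  have hmem : (fun x : G × G => x.1 * x.2⁻¹) ⁻¹' W ∈ 𝓝 (g, g) :=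
    hcont.continuousAt.preimage_mem_nhds (hW.mem_nhds (by simpa using h1W))
  rw [nhds_prod_eq, mem_prod_same_iff] at hmem
  obtain ⟨V', hV', hVW⟩ := hmem
  obtain ⟨V, hVV', hVo, hgV⟩ := mem_nhds_iff.1 hV'
  have hinj : Set.InjOn (proj Γ) V := by
    intro x hx y hy hxy
    obtain ⟨γ, hγ⟩ := (proj_eq_iff Γ x y).1 hxy
    have hmemW : x * y⁻¹ ∈ W := hVW (Set.mk_mem_prod (hVV' hx) (hVV' hy))
    rw [← hγ, mul_inv_cancel_right] at hmemW
    have : γ ∈ ({1} : Set Γ) := hW1 ▸ hmemW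
    rw [Set.mem_singleton_iff.1 this] at hγ
    simpa using hγ.symm
  have hle : (μ.restrict V).map (proj Γ) ≤ inducedMeasure Γ μ :=
    le_iSup₂ (f := fun (E : Set G) (_ : MeasurableSet E ∧ Set.InjOn (proj Γ) E) =>
      (μ.restrict E).map (proj Γ)) V ⟨hVo.measurableSet, hinj⟩
  refine ⟨proj Γ ⁻¹' N ∩ V, inter_mem self_mem_nhdsWithin
    (mem_nhdsWithin_of_mem_nhds (hVo.mem_nhds hgV)), ?_⟩
  have := hle N
  rwa [h, nonpos_iff_eq_zero, Measure.map_apply hπ hN, Measure.restrict_apply (hπ hN)] at this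

/-! ### The unipotent flow -/

lemma tendsto_abs_add_mul_cocompact (a : ℝ) {b : ℝ} (hb : b ≠ 0) :
    Tendsto (fun t : ℝ => |a + t * b|) (cocompact ℝ) atTop := by
  have h1 : Tendsto (fun t : ℝ => ‖t‖ * |b| + -|a|) (cocompact ℝ) atTop :=
    tendsto_atTop_add_const_right _ _
      ((tendsto_norm_cocompact_atTop).atTop_mul_const (abs_pos.2 hb))
  refine tendsto_atTop_mono (fun t => ?_) h1
  rw [Real.norm_eq_abs, ← abs_mul]
  have := abs_sub_abs_le_abs_sub (t * b) (-a)
  rw [abs_neg, sub_neg_eq_add, add_comm (t * b) a] at this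
  linarith

lemma volume_setOf_lt_lt_top {F : ℝ → ℝ} (hF : Tendsto F (cocompact ℝ) atTop) (R : ℝ) :
    volume {t : ℝ | F t < R} < ∞ := by
  obtain ⟨C, hC, hCs⟩ := mem_cocompact.1 (hF.eventually_ge_atTop R)
  refine (measure_mono fun t ht => ?_).trans_lt hC.measure_lt_top
  by_contra hn
  exact (not_le.2 (show F t < R from ht)) (show R ≤ F t from hCs hn)

end Kleinian

end

open Kleinian in
theorem mainTheorem10 (Γ : Subgroup Kleinian.G) (hdisc : DiscreteTopology Γ)
    (hne : Kleinian.NonElementary Γ) (hfg : Γ.FG) (hF : Kleinian.IsFuchsian Γ)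
    (ν : Kleinian.H3 → Measure Kleinian.Bd) (hν : Kleinian.IsPSDensity Γ ν) :
    ¬ Kleinian.UErgodic Γ (Kleinian.mBR Γ ν) ∧
    (∀ h : Kleinian.G, (∀ γ ∈ Γ, h⁻¹ * γ * h ∈ Kleinian.PSL2R) →
      ∀ᵐ x ∂(Kleinian.mBR Γ ν), ∀ g : Kleinian.G, Kleinian.proj Γ g = x →
        Tendsto (fun t : ℝ => Kleinian.planeDist h (g * Kleinian.u t)) (cocompact ℝ) atTop) ∧
    (∀ᵐ x ∂(Kleinian.mBR Γ ν),
      Tendsto (fun t : ℝ => Kleinian.flow Γ t x) (cocompact ℝ) (cocompact (Kleinian.X Γ))) ∧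
    ¬ Kleinian.UConservative Γ (Kleinian.mBR Γ ν) := by
  have hcircle : ∀ h : G, (∀ γ ∈ Γ, h⁻¹ * γ * h ∈ PSL2R) → ∀ A : SL(2, ℂ), toPSL A = h⁻¹ →
      ∀ᵐ ξ ∂(ν o), (formCoeff (A * kMat ξ)).2.2 = 0 := by
    intro h hh A hA
    refine measure_mono_null (Set.compl_subset_compl.2 (limitSet_subset Γ A fun γ hγ => ?_))
      (hν.supported o)
    rw [hA, inv_inv]
    exact hh γ hγ
  -- The slope tends to infinity along the orbit of almost every point.
  have hgood : ∀ h : G, (∀ γ ∈ Γ, h⁻¹ * γ * h ∈ PSL2R) → ∀ f : X Γ → ℝ × ℝ × ℝ, Continuous f →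
      (∀ g, f (proj Γ g) = planeForm (h⁻¹ * g)) →
      ∀ᵐ x ∂(mBR Γ ν), Tendsto (fun t : ℝ => |(f (flow Γ t x)).1 + (f (flow Γ t x)).2.2|)
        (cocompact ℝ) atTop := by
    intro h hh f hf hfproj
    have hfm := hf.measurable
    have hD : MeasurableSet {x | (f x).2.2 = 0 ∧ (f x).2.1 ≠ 0} :=
      (hfm.snd.snd (measurableSet_singleton 0)).inter
        (hfm.snd.fst (measurableSet_singleton 0).compl)
    have h1 : ∀ᵐ x ∂(mBR Γ ν), (f x).2.2 = 0 ∧ (f x).2.1 ≠ 0 := by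
      refine inducedMeasure_eq_zero Γ _ hD.compl ?_
      have := ae_brLift Γ ν h (hcircle h hh)
      simp only [← hfproj] at this
      exact this
    filter_upwards [h1] with x hx
    obtain ⟨g, rfl⟩ := Quotient.exists_rep x
    change Tendsto (fun t : ℝ => |(f (proj Γ (g * u t))).1 + (f (proj Γ (g * u t))).2.2|) _ _
    have hx' : (f (proj Γ g)).2.2 = 0 ∧ (f (proj Γ g)).2.1 ≠ 0 := hx
    rw [hfproj] at hx'
    have h2 : ∀ t : ℝ, (f (proj Γ (g * u t))).1 + (f (proj Γ (g * u t))).2.2 =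
        (planeForm (h⁻¹ * g)).1 + t * (planeForm (h⁻¹ * g)).2.1 := fun t => by
      rw [hfproj, ← mul_assoc, planeForm_mul_u, hx'.1]
      simp
    simp only [h2]
    exact tendsto_abs_add_mul_cocompact _ hx'.2
  obtain ⟨h, hh⟩ := hF
  obtain ⟨f, hf, hfproj⟩ := exists_continuous_planeForm_proj Γ h hh
  have hfm := hf.measurable
  -- Both signs of `Q` occur with positive measure.
  have hpos : ∀ ε : ℝ, ε = 1 ∨ ε = -1 → mBR Γ ν {x | (f x).2.2 = 0 ∧ 0 < ε * (f x).2.1} ≠ 0 := by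
    intro ε hε hzero
    have hB : MeasurableSet {x | (f x).2.2 = 0 ∧ 0 < ε * (f x).2.1} :=
      (hfm.snd.snd (measurableSet_singleton 0)).inter
        (measurableSet_lt measurable_const (hfm.snd.fst.const_mul ε))
    have := measure_preimage_proj_eq_zero Γ _ hB hzero
    refine brLift_ne_zero Γ ν h (hν.ne_zero o) (hcircle h hh) hε ?_
    simp only [← hfproj]
    exact this
  refine ⟨fun herg => ?_, fun h' hh' => ?_, ?_, fun hcons => ?_⟩
  · set B : Set (X Γ) := {x | (f x).2.2 = 0 ∧ 0 < 1 * (f x).2.1} with hB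
    have hBm : MeasurableSet B := (hfm.snd.snd (measurableSet_singleton 0)).inter
        (measurableSet_lt measurable_const (hfm.snd.fst.const_mul 1))
    have hinv : ∀ t : ℝ, flow Γ t ⁻¹' B = B := by
      intro t
      ext x
      obtain ⟨g, rfl⟩ := Quotient.exists_rep x
      change ((f (proj Γ (g * u t))).2.2 = 0 ∧ 0 < 1 * (f (proj Γ (g * u t))).2.1) ↔
        ((f (proj Γ g)).2.2 = 0 ∧ 0 < 1 * (f (proj Γ g)).2.1)
      rw [hfproj, hfproj, ← mul_assoc, planeForm_mul_u]
      refine and_congr_right fun h0 => ?_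
      have h0' : (planeForm (h⁻¹ * g)).2.2 = 0 := h0
      simp only [h0', mul_zero, add_zero]
    rcases herg B hBm hinv with h0 | h0
    · exact hpos 1 (Or.inl rfl) h0
    · refine hpos (-1) (Or.inr rfl) (measure_mono_null (fun x hx => Set.mem_compl fun hxB => ?_) h0)
      have h1 : 0 < -1 * (f x).2.1 := hx.2
      have h2 : 0 < 1 * (f x).2.1 := hxB.2
      linarith
  · obtain ⟨f', hf', hfproj'⟩ := exists_continuous_planeForm_proj Γ h' hh'
    filter_upwards [hgood h' hh' f' hf' hfproj'] with x hx g hg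
    refine tendsto_planeDist h' _ ?_
    subst hg
    simp only [flow_proj, hfproj', ← slope_smul_o] at hx
    exact hx
  · filter_upwards [hgood h hh f hf hfproj] with x hx
    refine (hasBasis_cocompact.tendsto_right_iff).2 fun C hC => ?_
    have hcont : ContinuousOn (fun y => |(f y).1 + (f y).2.2|) C := by fun_prop
    obtain ⟨R, hR⟩ := hC.bddAbove_image hcont
    filter_upwards [hx.eventually_gt_atTop R] with t ht hmem
    exact absurd (hR ⟨_, hmem, rfl⟩) (not_le.2 ht)
  -- Conservativity would make all sublevel sets of the slope null, and they cover `Γ \ G`.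
  · have hnull : ∀ n : ℕ, mBR Γ ν {x | |(f x).1 + (f x).2.2| < n} = 0 := by
      intro n
      set S : Set (X Γ) := {x | |(f x).1 + (f x).2.2| < n} with hS
      have hSm : MeasurableSet S :=
        (isOpen_lt (by fun_prop) continuous_const).measurableSet
      by_contra hne0
      have h1 := hcons S hSm (pos_iff_ne_zero.2 hne0)
      have h2 := ae_restrict_of_ae (s := S) (hgood h hh f hf hfproj)
      have : (ae ((mBR Γ ν).restrict S)).NeBot :=
        ae_neBot.2 fun h0 => hne0 (Measure.restrict_eq_zero.1 h0)
      obtain ⟨x, hx1, hx2⟩ := (h1.and h2).exists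
      exact (volume_setOf_lt_lt_top hx2 n).ne hx1
    refine hpos 1 (Or.inl rfl) (measure_mono_null (fun x _ => ?_) (measure_iUnion_null hnull))
    exact Set.mem_iUnion.2 (exists_nat_gt |(f x).1 + (f x).2.2|)
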